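/- Let $\Gamma=(V,E,w)$ be a finite simple digraph with vertex set $V=\{1,\dots,n\}$, edge set $E\subseteq V\times V$ (no loops), and non-negative weights $w\colon V\times V\to\mathbb{R}_{\ge 0}$, where $w_{ij}=0$ if and only if $(i,j)\notin E$. Let $L=D-A$ be its graph Laplacian, where $A=[w_{ij}]_{i,j=1}^n$ and $D$ is the diagonal matrix of the out-degrees $d^+(i)=\sum_{j\in V}w_{ij}$. A strongly connected component of $\Gamma$ is a maximal non-empty induced subgraph in which, for any two distinct vertices $i,j$, there is a directed path from $i$ to $j$ and a directed path from $j$ to $i$; a strongly connected component with vertex set $V'$ is called isolated if $w_{ij}=0$ for all $i\in V'$ and $j\in V\setminus V'$ (no edge leaves $V'$). Then, for every $k\in\mathbb{N}$ (including $k=0$), the following statements are equivalent: \begin{enumerate} \item[(i)] the algebraic multiplicity of $0$ as an eigenvalue of $L$ (its multiplicity as a root of the characteristic polynomial) is equal to $k$; \item[(ii)] there are exactly $k$ isolated strongly connected components of $\Gamma$; \item[(iii)] the geometric multiplicity of $0$ as an eigenvalue of $L$ (the dimension of the eigenspace $\ker L$) is equal to $k$. \end{enumerate} -/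

import Mathlib

open scoped NNReal

/-- A simple digraph with vertex set `V` and nonnegative edge weights: there are no loops, and
`weight i j = 0` exactly when there is no edge from `i` to `j`. -/
structure WeightedDigraph (V : Type*) extends Digraph V where
  weight : V → V → ℝ≥0
  weight_eq_zero_iff : ∀ i j, weight i j = 0 ↔ ¬ Adj i j
  loopless : ∀ i, ¬ Adj i i

namespace WeightedDigraph

/-- The out-degree of a vertex: the sum of the weights of the edges leaving it. -/
def outDegree {V : Type*} [Fintype V] (Γ : WeightedDigraph V) (i : V) : ℝ :=
  ∑ j, (Γ.weight i j : ℝ)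

/-- The weighted adjacency matrix. -/
def adjMatrix {V : Type*} (Γ : WeightedDigraph V) : Matrix V V ℝ :=
  Matrix.of fun i j => (Γ.weight i j : ℝ)

/-- The graph Laplacian: out-degree matrix minus weighted adjacency matrix. -/
noncomputable def laplacian {V : Type*} [Fintype V] [DecidableEq V] (Γ : WeightedDigraph V) :
    Matrix V V ℝ :=
  Matrix.diagonal Γ.outDegree - Γ.adjMatrix

/-- The subgraph induced on a set of vertices. -/
def induce {V : Type*} (Γ : WeightedDigraph V) (S : Set V) : WeightedDigraph S where
  Adj i j := Γ.Adj i j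
  weight i j := Γ.weight i j
  weight_eq_zero_iff i j := Γ.weight_eq_zero_iff i j
  loopless i := Γ.loopless i

/-- There is a directed path (with at least one edge) from `i` to `j`. -/
def HasPath {V : Type*} (Γ : WeightedDigraph V) (i j : V) : Prop :=
  Relation.TransGen Γ.Adj i j

/-- Any two distinct vertices are joined by directed paths in both directions. -/
def StronglyConnected {V : Type*} (Γ : WeightedDigraph V) : Prop :=
  ∀ i j, i = j ∨ (Γ.HasPath i j ∧ Γ.HasPath j i)

/-- `S` is the vertex set of a strongly connected component, that is, of a maximal (nonempty)
strongly connected induced subgraph. -/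
def IsStronglyConnectedComponent {V : Type*} (Γ : WeightedDigraph V) (S : Set V) : Prop :=
  Maximal (fun T : Set V => T.Nonempty ∧ (Γ.induce T).StronglyConnected) S

/-- The subgraph induced on `S` is isolated: no edge leaves `S` (edges into `S` are allowed). -/
def IsIsolated {V : Type*} (Γ : WeightedDigraph V) (S : Set V) : Prop :=
  ∀ i ∈ S, ∀ j ∉ S, Γ.weight i j = 0

/-- The number of isolated strongly connected components. -/
noncomputable def numIsolatedComponents {V : Type*} (Γ : WeightedDigraph V) : ℕ :=
  Set.ncard {S : Set V | Γ.IsStronglyConnectedComponent S ∧ Γ.IsIsolated S}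

end WeightedDigraph

/-- The multiplicity of `μ` as a complex root of the characteristic polynomial of a real matrix. -/
noncomputable def algebraicMultiplicity {V : Type*} [Fintype V] [DecidableEq V]
    (M : Matrix V V ℝ) (μ : ℂ) : ℕ :=
  (M.map Complex.ofReal).charpoly.rootMultiplicity μ

/-- The complex dimension of the eigenspace of a real matrix for the complex number `μ`. -/
noncomputable def geometricMultiplicity {V : Type*} [Fintype V] [DecidableEq V]
    (M : Matrix V V ℝ) (μ : ℂ) : ℕ :=
  Module.finrank ℂ (Module.End.eigenspace (Matrix.toLin' (M.map Complex.ofReal)) μ)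

/-!
The isolated components are the minimal nonempty sets of vertices that no edge leaves. Suppose that
the norm of a vertex function `f` is maximal at `i` and that `L f` vanishes at `i`. Since `(L f) i`
is a nonnegative combination of the differences `f i - f j`, each of which has nonnegative inner
product with `f i`, the function takes the value `f i` at every out-neighbour of `i`. If moreover
`L f = 0` off a set `B` and `f = 0` on `B`, then a nonzero maximal level set of `f` avoids `B` and
no edge leaves it, so it contains an isolated component. Hence `f = 0` as soon as `B` meets every
isolated component, and then, the dimension being finite, values on `B` can be prescribed at will.
Taking one vertex in each isolated component shows that a function in the kernel of `L` is
determined by its values there; taking the union of the components shows that it can be an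
arbitrary constant on each of them.

For the algebraic multiplicity, the same sign condition at a vertex of maximal norm gives
`‖f‖ ≤ ‖f + t L f‖` in the supremum norm for all `t ≥ 0`. If `L (L f) = 0`, applying this to
`f - t L f` bounds `t ‖L f‖` by `2 ‖f‖` for all `t ≥ 0`, so `L f = 0`: the eigenvalue `0`
has no nontrivial Jordan block.
-/

open scoped InnerProductSpace

theorem real_inner_self_sub_nonneg {E : Type*} [NormedAddCommGroup E] [InnerProductSpace ℝ E]
    {x y : E} (h : ‖y‖ ≤ ‖x‖) : 0 ≤ ⟪x, x - y⟫_ℝ := by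
  rw [inner_sub_right, real_inner_self_eq_norm_sq]
  nlinarith [real_inner_le_norm x y, norm_nonneg x]

section Accretive

variable {E : Type*} [NormedAddCommGroup E] [NormedSpace ℝ E]

/-- A map of a normed space is *accretive* if every `1 + t T` with `t ≥ 0` expands norms; for
linear maps this says that `-T` is dissipative. -/
def IsAccretive (T : E → E) : Prop :=
  ∀ t : ℝ, 0 ≤ t → ∀ x, ‖x‖ ≤ ‖x + t • T x‖

namespace IsAccretive

theorem apply_eq_zero_of_apply_apply_eq_zero {𝕜 : Type*} [Semiring 𝕜] [Algebra ℝ 𝕜] [Module 𝕜 E]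
    [IsScalarTower ℝ 𝕜 E] {T : Module.End 𝕜 E} (hT : IsAccretive T) {x : E}
    (hx : T (T x) = 0) : T x = 0 := by
  have norm_sub_le_norm (t : ℝ) (ht : 0 ≤ t) : ‖x - t • T x‖ ≤ ‖x‖ := by
    -- `(1 + t T) (x - t T x) = x`, because `T (T x) = 0`.
    simpa [T.map_smul_of_tower, hx] using hT t ht (x - t • T x)
  have mul_norm_le (t : ℝ) (ht : 0 ≤ t) : t * ‖T x‖ ≤ 2 * ‖x‖ := by
    calc t * ‖T x‖ = ‖x - (x - t • T x)‖ := by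
          rw [sub_sub_cancel, norm_smul, Real.norm_of_nonneg ht]
      _ ≤ ‖x‖ + ‖x - t • T x‖ := norm_sub_le _ _
      _ ≤ 2 * ‖x‖ := by linarith [norm_sub_le_norm t ht]
  by_contra hne
  have hpos : 0 < ‖T x‖ := norm_pos_iff.2 hne
  have := mul_norm_le ((2 * ‖x‖ + 1) / ‖T x‖) (by positivity)
  rw [div_mul_cancel₀ _ hpos.ne'] at this
  linarith

theorem maxGenEigenspace_zero {𝕜 : Type*} [Field 𝕜] [Algebra ℝ 𝕜] [Module 𝕜 E]
    [IsScalarTower ℝ 𝕜 E] {T : Module.End 𝕜 E} (hT : IsAccretive T) :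
    T.maxGenEigenspace 0 = T.eigenspace 0 := by
  have ker_eq_ker_sq : LinearMap.ker (T ^ 1) = LinearMap.ker (T ^ 2) := by
    ext x
    simp only [pow_one, pow_two, LinearMap.mem_ker, Module.End.mul_apply]
    exact ⟨fun h => by rw [h, map_zero], hT.apply_eq_zero_of_apply_apply_eq_zero⟩
  refine le_antisymm (fun x hx => ?_) Module.End.eigenspace_le_maxGenEigenspace
  obtain ⟨k, hk⟩ := (Module.End.mem_maxGenEigenspace T 0 x).1 hx
  rw [zero_smul, sub_zero] at hk
  have hk' : x ∈ LinearMap.ker (T ^ (1 + k)) := by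
    rw [LinearMap.mem_ker, pow_add, Module.End.mul_apply, hk, map_zero]
  rwa [← Module.End.ker_pow_constant ker_eq_ker_sq, pow_one, ← Module.End.eigenspace_zero] at hk'

end IsAccretive

theorem algebraicMultiplicity_zero_eq_geometricMultiplicity_zero {V : Type*} [Fintype V]
    [DecidableEq V] {M : Matrix V V ℝ}
    (hM : IsAccretive (Matrix.toLin' (M.map Complex.ofReal))) :
    algebraicMultiplicity M 0 = geometricMultiplicity M 0 := by
  rw [algebraicMultiplicity, geometricMultiplicity, ← hM.maxGenEigenspace_zero,
    LinearMap.finrank_maxGenEigenspace_eq, Matrix.charpoly_toLin']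

end Accretive

namespace WeightedDigraph

section Isolated

variable {V : Type*} {Γ : WeightedDigraph V} {S T : Set V}

theorem isIsolated_iff_forall_adj : Γ.IsIsolated S ↔ ∀ i ∈ S, ∀ j, Γ.Adj i j → j ∈ S := by
  simp only [IsIsolated, Γ.weight_eq_zero_iff, not_imp_not]

theorem IsIsolated.inter (hS : Γ.IsIsolated S) (hT : Γ.IsIsolated T) : Γ.IsIsolated (S ∩ T) := by
  rw [isIsolated_iff_forall_adj] at *
  exact fun i hi j hij => ⟨hS i hi.1 j hij, hT i hi.2 j hij⟩

theorem IsIsolated.preimage_val (hT : Γ.IsIsolated T) :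
    (Γ.induce S).IsIsolated ((↑) ⁻¹' T) :=
  fun i hi j hj => hT i hi j hj

theorem IsIsolated.image_val (hS : Γ.IsIsolated S) {T : Set S}
    (hT : (Γ.induce S).IsIsolated T) : Γ.IsIsolated ((↑) '' T) := by
  rw [isIsolated_iff_forall_adj] at *
  rintro _ ⟨i, hi, rfl⟩ j hij
  exact ⟨⟨j, hS i i.2 j hij⟩, hT i hi _ hij, rfl⟩

theorem isIsolated_setOf_reflTransGen (Γ : WeightedDigraph V) (i : V) :
    Γ.IsIsolated {j | Relation.ReflTransGen Γ.Adj i j} :=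
  isIsolated_iff_forall_adj.2 fun _ hj _ hjk => hj.tail hjk

theorem IsIsolated.mem_of_reflTransGen (hS : Γ.IsIsolated S) {i j : V} (hi : i ∈ S)
    (hij : Relation.ReflTransGen Γ.Adj i j) : j ∈ S := by
  induction hij with
  | refl => exact hi
  | tail _ hjk hj => exact isIsolated_iff_forall_adj.1 hS _ hj _ hjk

theorem stronglyConnected_iff_forall_reflTransGen :
    Γ.StronglyConnected ↔ ∀ i j, Relation.ReflTransGen Γ.Adj i j := by
  simp only [StronglyConnected, HasPath, Relation.reflTransGen_iff_eq_or_transGen]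
  grind

theorem stronglyConnected_iff_forall_isIsolated :
    Γ.StronglyConnected ↔ ∀ S, S.Nonempty → Γ.IsIsolated S → S = Set.univ := by
  rw [stronglyConnected_iff_forall_reflTransGen]
  constructor
  · rintro h S ⟨i, hi⟩ hS
    exact Set.eq_univ_of_forall fun j => hS.mem_of_reflTransGen hi (h i j)
  · intro h i j
    exact Set.eq_univ_iff_forall.1 (h _ ⟨i, .refl⟩ (Γ.isIsolated_setOf_reflTransGen i)) j

theorem IsIsolated.subset_of_stronglyConnected_induce (hT : Γ.IsIsolated T)
    (hS : (Γ.induce S).StronglyConnected) (hST : (S ∩ T).Nonempty) : S ⊆ T := by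
  obtain ⟨i, hiS, hiT⟩ := hST
  have preimage_eq_univ : ((↑) ⁻¹' T : Set S) = Set.univ :=
    stronglyConnected_iff_forall_isIsolated.1 hS _ ⟨⟨i, hiS⟩, hiT⟩ hT.preimage_val
  exact fun j hj => Set.eq_univ_iff_forall.1 preimage_eq_univ ⟨j, hj⟩

theorem stronglyConnected_induce_of_minimal
    (hS : Minimal (fun T => T.Nonempty ∧ Γ.IsIsolated T) S) :
    (Γ.induce S).StronglyConnected := by
  refine stronglyConnected_iff_forall_isIsolated.2 fun T hne hT => ?_
  have image_val_eq : (↑) '' T = S :=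
    hS.eq_of_subset ⟨hne.image _, hS.prop.2.image_val hT⟩ (Subtype.coe_image_subset S T)
  refine Set.eq_univ_of_forall fun i => ?_
  rw [← Subtype.val_injective.mem_set_image, image_val_eq]
  exact i.2

/-- The vertex sets of the isolated strongly connected components. -/
def isolatedComponents (Γ : WeightedDigraph V) : Set (Set V) :=
  {S | Γ.IsStronglyConnectedComponent S ∧ Γ.IsIsolated S}

theorem mem_isolatedComponents_iff_minimal :
    S ∈ Γ.isolatedComponents ↔ Minimal (fun T => T.Nonempty ∧ Γ.IsIsolated T) S := by
  constructor
  · rintro ⟨⟨⟨hne, hconn⟩, -⟩, hS⟩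
    refine ⟨⟨hne, hS⟩, fun T ⟨hTne, hT⟩ hTS => ?_⟩
    exact hT.subset_of_stronglyConnected_induce hconn (hTne.mono (Set.subset_inter hTS le_rfl))
  · intro hmin
    obtain ⟨hne, hS⟩ := hmin.prop
    refine ⟨⟨⟨hne, stronglyConnected_induce_of_minimal hmin⟩, fun T ⟨_, hT⟩ hST => ?_⟩, hS⟩
    exact hS.subset_of_stronglyConnected_induce hT (hne.mono (Set.subset_inter hST le_rfl))

theorem nonempty_of_mem_isolatedComponents (hS : S ∈ Γ.isolatedComponents) : S.Nonempty :=
  hS.1.prop.1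

theorem pairwiseDisjoint_isolatedComponents (Γ : WeightedDigraph V) :
    Γ.isolatedComponents.PairwiseDisjoint id := by
  refine fun S hS T hT => not_imp_comm.1 fun hST => ?_
  have hne : (S ∩ T).Nonempty := Set.not_disjoint_iff_nonempty_inter.1 hST
  have hiso : Γ.IsIsolated (S ∩ T) := hS.2.inter hT.2
  rw [mem_isolatedComponents_iff_minimal] at hS hT
  exact (hS.eq_of_subset ⟨hne, hiso⟩ Set.inter_subset_left).symm.trans
    (hT.eq_of_subset ⟨hne, hiso⟩ Set.inter_subset_right)

theorem IsIsolated.exists_isolatedComponent_subset [Finite V] (hS : Γ.IsIsolated S)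
    (hne : S.Nonempty) : ∃ T ∈ Γ.isolatedComponents, T ⊆ S := by
  obtain ⟨T, hTS, hT⟩ := exists_minimal_le_of_wellFoundedLT
    (fun T : Set V => T.Nonempty ∧ Γ.IsIsolated T) S ⟨hne, hS⟩
  exact ⟨T, mem_isolatedComponents_iff_minimal.2 hT, hTS⟩

end Isolated

variable {V : Type*} [Fintype V]

section LaplacianLinearMap

variable (𝕜 : Type*) {E : Type*} [Semiring 𝕜] [AddCommGroup E] [Module ℝ E] [Module 𝕜 E]
  [SMulCommClass ℝ 𝕜 E]

variable (E) in
/-- The Laplacian of `Γ` acting on vertex functions with values in a real vector space `E`. It is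
linear over any scalars `𝕜` whose action commutes with that of `ℝ`, so that real and complex
functions are both covered. -/
def laplacianLinearMap (Γ : WeightedDigraph V) : Module.End 𝕜 (V → E) where
  toFun f i := ∑ j, (Γ.weight i j : ℝ) • (f i - f j)
  map_add' f g := by
    ext i
    simp only [Pi.add_apply, ← Finset.sum_add_distrib, ← smul_add, add_sub_add_comm]
  map_smul' c f := by
    ext i
    simp only [Pi.smul_apply, RingHom.id_apply, Finset.smul_sum, ← smul_sub, smul_comm (_ : ℝ) c]

theorem laplacianLinearMap_apply (Γ : WeightedDigraph V) (f : V → E) (i : V) :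
    Γ.laplacianLinearMap 𝕜 E f i = ∑ j, (Γ.weight i j : ℝ) • (f i - f j) :=
  rfl

theorem IsIsolated.laplacianLinearMap_apply_eq_zero {Γ : WeightedDigraph V} {S : Set V}
    (hS : Γ.IsIsolated S) {f : V → E} {c : E} (hf : Set.EqOn f (fun _ => c) S) {i : V}
    (hi : i ∈ S) : Γ.laplacianLinearMap 𝕜 E f i = 0 := by
  rw [laplacianLinearMap_apply]
  refine Finset.sum_eq_zero fun j _ => ?_
  by_cases hj : j ∈ S
  · rw [hf hi, hf hj, sub_self, smul_zero]
  · rw [hS i hi j hj, NNReal.coe_zero, zero_smul]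

end LaplacianLinearMap

theorem toLin'_laplacian_map_ofReal [DecidableEq V] (Γ : WeightedDigraph V) :
    Matrix.toLin' (Γ.laplacian.map Complex.ofReal) = Γ.laplacianLinearMap ℂ ℂ := by
  refine LinearMap.ext fun f => funext fun i => ?_
  have hmap : Γ.laplacian.map Complex.ofReal =
      Matrix.diagonal (fun i => (Γ.outDegree i : ℂ)) - Γ.adjMatrix.map Complex.ofReal := by
    ext a b
    by_cases hab : a = b <;> simp [laplacian, hab]
  rw [Matrix.toLin'_apply, hmap, Matrix.sub_mulVec, Pi.sub_apply, Matrix.mulVec_diagonal]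
  simp only [Matrix.mulVec, dotProduct, Matrix.map_apply, adjMatrix, Matrix.of_apply, outDegree,
    laplacianLinearMap_apply, Complex.ofReal_sum, Complex.real_smul, mul_sub,
    Finset.sum_sub_distrib, Finset.sum_mul]

variable {𝕜 E : Type*} [NormedAddCommGroup E] [InnerProductSpace ℝ E]

section MaximumPrinciple

variable [Semiring 𝕜] [Module 𝕜 E] [SMulCommClass ℝ 𝕜 E] {Γ : WeightedDigraph V} {f : V → E}

variable (𝕜) in
theorem inner_laplacianLinearMap_apply (Γ : WeightedDigraph V) (f : V → E) (i : V) :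
    ⟪f i, Γ.laplacianLinearMap 𝕜 E f i⟫_ℝ = ∑ j, (Γ.weight i j : ℝ) * ⟪f i, f i - f j⟫_ℝ := by
  simp only [laplacianLinearMap_apply, inner_sum, real_inner_smul_right]

theorem inner_laplacianLinearMap_apply_nonneg {i : V} (hmax : ∀ j, ‖f j‖ ≤ ‖f i‖) :
    0 ≤ ⟪f i, Γ.laplacianLinearMap 𝕜 E f i⟫_ℝ := by
  rw [inner_laplacianLinearMap_apply]
  exact Finset.sum_nonneg fun j _ =>
    mul_nonneg NNReal.zero_le_coe (real_inner_self_sub_nonneg (hmax j))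

theorem eq_of_adj_of_laplacianLinearMap_apply_eq_zero {i j : V} (hmax : ∀ k, ‖f k‖ ≤ ‖f i‖)
    (hL : Γ.laplacianLinearMap 𝕜 E f i = 0) (hij : Γ.Adj i j) : f j = f i := by
  have sum_eq_zero : ∑ k, (Γ.weight i k : ℝ) * ⟪f i, f i - f k⟫_ℝ = 0 := by
    rw [← inner_laplacianLinearMap_apply 𝕜, hL, inner_zero_right]
  have term_eq_zero := (Finset.sum_eq_zero_iff_of_nonneg fun k _ =>
    mul_nonneg NNReal.zero_le_coe (real_inner_self_sub_nonneg (hmax k))).1 sum_eq_zero j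
      (Finset.mem_univ j)
  have weight_ne_zero : (Γ.weight i j : ℝ) ≠ 0 :=
    NNReal.coe_ne_zero.2 fun h => (Γ.weight_eq_zero_iff i j).1 h hij
  have inner_eq : ⟪f j, f i⟫_ℝ = ‖f i‖ ^ 2 := by
    have := (mul_eq_zero.1 term_eq_zero).resolve_left weight_ne_zero
    rw [inner_sub_right, real_inner_self_eq_norm_sq, sub_eq_zero] at this
    rw [real_inner_comm, this]
  exact eq_of_norm_le_re_inner_eq_norm_sq (𝕜 := ℝ) (hmax j) inner_eq

variable (𝕜 E) in
theorem isAccretive_laplacianLinearMap (Γ : WeightedDigraph V) :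
    IsAccretive (Γ.laplacianLinearMap 𝕜 E) := by
  intro t ht f
  refine (pi_norm_le_iff_of_nonneg (norm_nonneg _)).2 fun k => ?_
  have : Nonempty V := ⟨k⟩
  obtain ⟨i, hmax⟩ := Finite.exists_max (‖f ·‖)
  set g := f + t • Γ.laplacianLinearMap 𝕜 E f with hg
  have sq_le : ‖f i‖ * ‖f i‖ ≤ ‖f i‖ * ‖g i‖ := by
    calc ‖f i‖ * ‖f i‖ = ⟪f i, f i⟫_ℝ := (real_inner_self_eq_norm_mul_norm _).symm
      _ ≤ ⟪f i, f i⟫_ℝ + t * ⟪f i, Γ.laplacianLinearMap 𝕜 E f i⟫_ℝ :=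
        le_add_of_nonneg_right (mul_nonneg ht (inner_laplacianLinearMap_apply_nonneg hmax))
      _ = ⟪f i, g i⟫_ℝ := by
        rw [hg, Pi.add_apply, Pi.smul_apply, inner_add_right, real_inner_smul_right]
      _ ≤ ‖f i‖ * ‖g i‖ := real_inner_le_norm _ _
  have norm_le : ‖f i‖ ≤ ‖g i‖ := by
    rcases (norm_nonneg (f i)).eq_or_lt with h | h
    · exact h ▸ norm_nonneg _
    · exact le_of_mul_le_mul_left sq_le h
  exact (hmax k).trans (norm_le.trans (norm_le_pi_norm g i))

theorem eq_zero_of_laplacianLinearMap_eq_zero_compl {B : Set V}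
    (hB : ∀ S ∈ Γ.isolatedComponents, (S ∩ B).Nonempty) (hfB : ∀ i ∈ B, f i = 0)
    (hL : ∀ i ∉ B, Γ.laplacianLinearMap 𝕜 E f i = 0) : f = 0 := by
  by_contra hf
  obtain ⟨k, hk⟩ := Function.ne_iff.1 hf
  have : Nonempty V := ⟨k⟩
  obtain ⟨i, hmax⟩ := Finite.exists_max (‖f ·‖)
  have hi : f i ≠ 0 := norm_pos_iff.1 ((norm_pos_iff.2 hk).trans_le (hmax k))
  have level_disjoint (j : V) (hj : f j = f i) : j ∉ B := fun hjB => hi (hj ▸ hfB j hjB)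
  have level_isolated : Γ.IsIsolated {j | f j = f i} :=
    isIsolated_iff_forall_adj.2 fun j (hj : f j = f i) l hjl =>
      (eq_of_adj_of_laplacianLinearMap_apply_eq_zero (by rwa [hj]) (hL j (level_disjoint j hj))
        hjl).trans hj
  obtain ⟨S, hS, hSsub⟩ := level_isolated.exists_isolatedComponent_subset ⟨i, rfl⟩
  obtain ⟨j, hjS, hjB⟩ := hB S hS
  exact level_disjoint j (hSsub hjS) hjB

end MaximumPrinciple

section Kernel

variable [DivisionRing 𝕜] [Module 𝕜 E] [SMulCommClass ℝ 𝕜 E] [FiniteDimensional 𝕜 E]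

theorem exists_eqOn_laplacianLinearMap_eq_zero_compl {Γ : WeightedDigraph V} {B : Set V}
    (hB : ∀ S ∈ Γ.isolatedComponents, (S ∩ B).Nonempty) (g : V → E) :
    ∃ f : V → E, Set.EqOn f g B ∧ ∀ i ∉ B, Γ.laplacianLinearMap 𝕜 E f i = 0 := by
  classical
  let dirichlet : Module.End 𝕜 (V → E) := LinearMap.pi fun i =>
    if i ∈ B then LinearMap.proj i else LinearMap.proj i ∘ₗ Γ.laplacianLinearMap 𝕜 E
  have dirichlet_of_mem (f) (i) (hi : i ∈ B) : dirichlet f i = f i := by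
    simp [dirichlet, hi]
  have dirichlet_of_notMem (f) (i) (hi : i ∉ B) :
      dirichlet f i = Γ.laplacianLinearMap 𝕜 E f i := by
    simp [dirichlet, hi]
  have dirichlet_injective : Function.Injective dirichlet := by
    refine (injective_iff_map_eq_zero dirichlet).2 fun f hf => ?_
    refine eq_zero_of_laplacianLinearMap_eq_zero_compl (𝕜 := 𝕜) hB (fun i hi => ?_) fun i hi => ?_
    · rw [← dirichlet_of_mem f i hi, hf, Pi.zero_apply]
    · rw [← dirichlet_of_notMem f i hi, hf, Pi.zero_apply]
  obtain ⟨f, hf⟩ := LinearMap.injective_iff_surjective.1 dirichlet_injective (B.indicator g)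
  refine ⟨f, fun i hi => ?_, fun i hi => ?_⟩
  · rw [← dirichlet_of_mem f i hi, hf, Set.indicator_of_mem hi]
  · rw [← dirichlet_of_notMem f i hi, hf, Set.indicator_of_notMem hi]

theorem exists_mem_ker_laplacianLinearMap_eqOn (Γ : WeightedDigraph V)
    (c : Γ.isolatedComponents → E) :
    ∃ f ∈ LinearMap.ker (Γ.laplacianLinearMap 𝕜 E),
      ∀ S : Γ.isolatedComponents, Set.EqOn f (fun _ => c S) S := by
  let vertex : (Σ S : Γ.isolatedComponents, S.1) → V := fun p => p.2
  have vertex_injective : Function.Injective vertex := by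
    rintro ⟨S, i, hi⟩ ⟨T, j, hj⟩ (rfl : i = j)
    obtain rfl : S = T :=
      Subtype.ext (Γ.pairwiseDisjoint_isolatedComponents.elim_set S.2 T.2 i hi hj)
    rfl
  obtain ⟨f, hfg, hL⟩ := exists_eqOn_laplacianLinearMap_eq_zero_compl (𝕜 := 𝕜) (Γ := Γ)
    (B := ⋃₀ Γ.isolatedComponents)
    (fun S hS => by
      rw [Set.inter_eq_left.2 (Set.subset_sUnion_of_mem hS)]
      exact nonempty_of_mem_isolatedComponents hS)
    (Function.extend vertex (fun p => c p.1) 0)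
  have eqOn_const (S : Γ.isolatedComponents) : Set.EqOn f (fun _ => c S) S := fun i hi =>
    (hfg ⟨S, S.2, hi⟩).trans (vertex_injective.extend_apply _ _ ⟨S, i, hi⟩)
  refine ⟨f, LinearMap.mem_ker.2 (funext fun i => ?_), eqOn_const⟩
  by_cases hi : i ∈ ⋃₀ Γ.isolatedComponents
  · obtain ⟨S, hS, hiS⟩ := hi
    exact hS.2.laplacianLinearMap_apply_eq_zero 𝕜 (eqOn_const ⟨S, hS⟩) hiS
  · exact hL i hi

theorem bijective_restrict_ker_laplacianLinearMap {Γ : WeightedDigraph V}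
    {r : Γ.isolatedComponents → V} (hr : ∀ S, r S ∈ S.1) :
    Function.Bijective
      ((LinearMap.funLeft 𝕜 E r).domRestrict (LinearMap.ker (Γ.laplacianLinearMap 𝕜 E))) := by
  constructor
  · refine (injective_iff_map_eq_zero _).2 fun ⟨f, hf⟩ hfr => Subtype.ext ?_
    refine eq_zero_of_laplacianLinearMap_eq_zero_compl (𝕜 := 𝕜) (Γ := Γ) (B := Set.range r)
      (fun S hS => ⟨r ⟨S, hS⟩, hr ⟨S, hS⟩, ⟨S, hS⟩, rfl⟩) ?_
      (fun i _ => congrFun (LinearMap.mem_ker.1 hf) i)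
    exact Set.forall_mem_range.2 (congrFun hfr)
  · intro c
    obtain ⟨f, hf, hfc⟩ := Γ.exists_mem_ker_laplacianLinearMap_eqOn (𝕜 := 𝕜) c
    exact ⟨⟨f, hf⟩, funext fun S => hfc S (hr S)⟩

variable (𝕜 E) in
theorem finrank_ker_laplacianLinearMap (Γ : WeightedDigraph V) :
    Module.finrank 𝕜 (LinearMap.ker (Γ.laplacianLinearMap 𝕜 E)) =
      Γ.numIsolatedComponents * Module.finrank 𝕜 E := by
  classical
  choose r hr using fun S : Γ.isolatedComponents => nonempty_of_mem_isolatedComponents S.2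
  have card_eq : Fintype.card Γ.isolatedComponents = Γ.numIsolatedComponents :=
    Set.fintypeCard_eq_ncard _
  rw [(LinearEquiv.ofBijective _ (bijective_restrict_ker_laplacianLinearMap hr)).finrank_eq,
    Module.finrank_pi_fintype, Finset.sum_const, Finset.card_univ, card_eq, smul_eq_mul]

end Kernel

theorem algebraicMultiplicity_laplacian_zero [DecidableEq V] (Γ : WeightedDigraph V) :
    algebraicMultiplicity Γ.laplacian 0 = geometricMultiplicity Γ.laplacian 0 :=
  algebraicMultiplicity_zero_eq_geometricMultiplicity_zero <| by
    rw [Γ.toLin'_laplacian_map_ofReal]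
    exact Γ.isAccretive_laplacianLinearMap ℂ ℂ

theorem geometricMultiplicity_laplacian_zero [DecidableEq V] (Γ : WeightedDigraph V) :
    geometricMultiplicity Γ.laplacian 0 = Γ.numIsolatedComponents := by
  rw [geometricMultiplicity, Module.End.eigenspace_zero, Γ.toLin'_laplacian_map_ofReal,
    Γ.finrank_ker_laplacianLinearMap ℂ ℂ, Module.finrank_self, mul_one]

end WeightedDigraph

theorem mainTheorem8 {V : Type*} [Fintype V] [DecidableEq V] (Γ : WeightedDigraph V) (k : ℕ) :
    List.TFAE [
      algebraicMultiplicity Γ.laplacian 0 = k,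
      Γ.numIsolatedComponents = k,
      geometricMultiplicity Γ.laplacian 0 = k] := by
  rw [Γ.algebraicMultiplicity_laplacian_zero, Γ.geometricMultiplicity_laplacian_zero]
  tfae_finish
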